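/- All topological spaces are regular $T_1$-spaces, and $C_k(X,Y)$ denotes the space of all continuous maps from $X$ to $Y$ with the compact-open topology. A class $\mathcal X$ of topological spaces is called $C_k$-stable if it is closed under taking subspaces, homeomorphic images, countable (possibly finite or empty) topological sums and countable (possibly finite or empty) Tychonoff products, and if $C_k(X,Y)\in\mathcal X$ for every Lindelöf space $X\in\mathcal X$ and every space $Y\in\mathcal X$. Let $C_k[\mathcal M]$ be the $C_k$-stable closure of the class $\mathcal M$ of all metrizable spaces, that is, the smallest $C_k$-stable class containing $\mathcal M$. **Theorem.** A topological space $Z$ belongs to $C_k[\mathcal M]$ if and only if there are a separable metrizable space $X$, a metrizable space $Y$ and a topological embedding of $Z$ into $C_k(X,Y)$. -/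

import Mathlib

open Topology

universe u

/-- A class of topological spaces (whose underlying sets live in a fixed universe). -/
abbrev SpaceClass : Type (u + 1) := ∀ (Z : Type u) [TopologicalSpace Z], Prop

namespace SpaceClass

/-- Inclusion `𝒳 ⊆ 𝒴` of classes of topological spaces. -/
def Sub (𝒳 𝒴 : SpaceClass.{u}) : Prop :=
  ∀ (Z : Type u) [TopologicalSpace Z], 𝒳 Z → 𝒴 Z

/-- The class of all regular `T₁` spaces. -/
def regularT1 : SpaceClass.{u} := fun Z _ => T3Space Z

/-- The class `𝓜` of all metrizable spaces. -/
def metrizable : SpaceClass.{u} := fun Z _ => TopologicalSpace.MetrizableSpace Z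

/-- The class `𝓜₀` of all separable metrizable spaces. -/
def sepMetrizable : SpaceClass.{u} := fun Z _ => 
  TopologicalSpace.SeparableSpace Z ∧ TopologicalSpace.MetrizableSpace Z

/-- A class of regular `T₁` spaces is stable if it is closed under taking subspaces, homeomorphic
images, countable topological sums and countable Tychonoff products
(countable index sets may be finite or empty). -/
structure IsStable (𝒳 : SpaceClass.{u}) : Prop where
  regular : 𝒳.Sub regularT1
  subspace : ∀ (Z : Type u) [TopologicalSpace Z], 𝒳 Z → ∀ s : Set Z, 𝒳 s
  homeo : ∀ (Z W : Type u) [TopologicalSpace Z] [TopologicalSpace W],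
    𝒳 Z → Nonempty (Z ≃ₜ W) → 𝒳 W
  sum : ∀ (ι : Type) [Countable ι] (Z : ι → Type u) [∀ i, TopologicalSpace (Z i)],
    (∀ i, 𝒳 (Z i)) → 𝒳 (Σ i, Z i)
  prod : ∀ (ι : Type) [Countable ι] (Z : ι → Type u) [∀ i, TopologicalSpace (Z i)],
    (∀ i, 𝒳 (Z i)) → 𝒳 (∀ i, Z i)

/-- A class of regular `T₁` spaces is `C_k`-stable if it is stable and contains `C_k(X, Y)` for
every Lindelöf `X` and every `Y` in the class. Here `C(X, Y)` is the space of continuous maps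
with the compact-open topology. -/
structure IsCkStable (𝒳 : SpaceClass.{u}) : Prop extends IsStable 𝒳 where
  funSpace : ∀ (X Y : Type u) [TopologicalSpace X] [TopologicalSpace Y],
    LindelofSpace X → 𝒳 X → 𝒳 Y → 𝒳 C(X, Y)

/-- The `C_k`-stable closure of a class of regular `T₁` spaces: the intersection of all `C_k`-stable
classes that contain it. It is the smallest such class, see `ckClosure_least`. -/
def ckClosure (𝒳 : SpaceClass.{u}) : SpaceClass.{u} := fun Z _ =>
  ∀ 𝒴 : SpaceClass.{u}, IsCkStable 𝒴 → 𝒳.Sub 𝒴 → 𝒴 Z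

/-- The class `C_k(𝒳, 𝒴)` of all topological spaces that embed topologically into `C_k(X, Y)` for
some `X` in `𝒳` and some `Y` in `𝒴`. -/
def ckEmb (𝒳 𝒴 : SpaceClass.{u}) : SpaceClass.{u} := fun Z _ =>
  ∃ (X Y : Type u) (_ : TopologicalSpace X) (_ : TopologicalSpace Y),
    𝒳 X ∧ 𝒴 Y ∧ ∃ e : Z → C(X, Y), IsEmbedding e

/-- The class of all regular `T₁` spaces is `C_k`-stable, so that `C_k`-stable extensions exist. -/
theorem isCkStable_regularT1 : IsCkStable regularT1.{u} where
  regular := fun _ _ h => h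
  subspace := fun Z _ h s => by
    have : T3Space Z := h
    exact (inferInstance : T3Space s)
  homeo := fun Z W _ _ h e => by
    have : T3Space Z := h
    exact e.some.symm.isEmbedding.t3Space
  sum := fun ι _ Z _ h => by
    have : ∀ i, T3Space (Z i) := h
    have hr : RegularSpace (Σ i, Z i) := by
      refine RegularSpace.of_exists_mem_nhds_isClosed_subset ?_
      rintro ⟨i, z⟩ s hs
      obtain ⟨t, ht, hc, hts⟩ := exists_mem_nhds_isClosed_subset
        (continuous_sigmaMk.continuousAt (x := z) hs)
      exact ⟨Sigma.mk i '' t, IsOpenEmbedding.sigmaMk.image_mem_nhds.2 ht,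
        IsClosedEmbedding.sigmaMk.isClosedMap _ hc, Set.image_subset_iff.2 hts⟩
    exact (inferInstance : T3Space (Σ i, Z i))
  prod := fun ι _ Z _ h => by
    have : ∀ i, T3Space (Z i) := h
    exact (inferInstance : T3Space (∀ i, Z i))
  funSpace := fun X Y _ _ _ _ h => by
    have : T3Space Y := h
    exact (inferInstance : T3Space C(X, Y))

/-- The `C_k`-stable closure of a class of regular `T₁` spaces is its smallest `C_k`-stable
extension. -/
theorem ckClosure_least (𝒳 : SpaceClass.{u}) (h𝒳 : 𝒳.Sub regularT1) :
    IsCkStable (ckClosure 𝒳) ∧ 𝒳.Sub (ckClosure 𝒳) ∧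
      ∀ 𝒴 : SpaceClass.{u}, IsCkStable 𝒴 → 𝒳.Sub 𝒴 → (ckClosure 𝒳).Sub 𝒴 where
  left :=
    { regular := fun _ _ h => h _ isCkStable_regularT1 h𝒳
      subspace := fun Z _ h s 𝒴 hy hs => hy.subspace Z (h 𝒴 hy hs) s
      homeo := fun Z W _ _ h e 𝒴 hy hs => hy.homeo Z W (h 𝒴 hy hs) e
      sum := fun ι _ Z _ h 𝒴 hy hs => hy.sum ι Z fun i => h i 𝒴 hy hs
      prod := fun ι _ Z _ h 𝒴 hy hs => hy.prod ι Z fun i => h i 𝒴 hy hs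
      funSpace := fun X Y _ _ hL hX hY 𝒴 hy hs =>
        hy.funSpace X Y hL (hX 𝒴 hy hs) (hY 𝒴 hy hs) }
  right := ⟨fun Z _ h _ _ hs => hs Z h, fun 𝒴 hy hs _ _ h => h 𝒴 hy hs⟩

end SpaceClass

open Set Filter TopologicalSpace

/-! A separable metrizable `X` is Lindelöf, so every `C_k`-stable class containing the metrizable
spaces contains `C(X, Y)` and its subspaces. Conversely, the spaces embedding into such `C(X, Y)`
already form a `C_k`-stable class.

The hard closure property is that under function spaces. Let `X ⊆ C(A', B')` be Lindelöf and `Y ⊆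
C(A, B)`. If a separable metrizable `S` maps onto `X` so that compact sets lift to compact sets,
then `C(X, Y)` embeds into `C(S, C(A, B))`, hence into `C(S × A, B)`. Such an `S` consists of codes
in a Cantor cube (`exists_compactCovering_of_secondCountable`); compact sets lift because they are
evenly continuous (`IsCompact.exists_nhds_eventually_mapsTo`). -/

theorem TopologicalSpace.SeparableSpace.secondCountableTopology_of_metrizable (X : Type*)
    [TopologicalSpace X] [SeparableSpace X] [MetrizableSpace X] : SecondCountableTopology X := by
  let := pseudoMetrizableSpaceUniformity X
  have := pseudoMetrizableSpaceUniformity_countably_generated X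
  exact UniformSpace.secondCountable_of_separable X

/-! ### Embeddings and continuity in the compact-open topology -/

section CompactOpen

variable {X Y Z A B S : Type*} [TopologicalSpace X] [TopologicalSpace Y] [TopologicalSpace Z]
  [TopologicalSpace A] [TopologicalSpace B] [TopologicalSpace S]

/-- A map into a function space is continuous if all its restrictions to compact sets are. -/
theorem ContinuousMap.continuous_of_restrict {F : Z → C(X, Y)}
    (h : ∀ K : Set X, IsCompact K → Continuous fun z => (F z).restrict K) : Continuous F :=
  continuous_iff_continuousAt.2 fun z =>
    (ContinuousMap.tendsto_compactOpen_iff_forall F (F z)).2 fun K hK => (h K hK).tendsto z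

/-- Precomposition with a compact-covering map is an embedding of function spaces. -/
theorem ContinuousMap.isEmbedding_precomp_of_compactCovering (q : C(S, X))
    (hq : ∀ K : Set X, IsCompact K → ∃ L : Set S, IsCompact L ∧ q '' L = K) :
    IsEmbedding (fun f : C(X, Y) => f.comp q) := by
  have hs : Function.Surjective q := fun x => by
    obtain ⟨L, -, hL⟩ := hq {x} isCompact_singleton
    obtain ⟨s, -, hs⟩ : x ∈ q '' L := hL ▸ mem_singleton x
    exact ⟨s, hs⟩
  refine ⟨⟨le_antisymm (ContinuousMap.continuous_precomp q).le_induced ?_⟩, ?_⟩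
  · rw [ContinuousMap.compactOpen_eq (X := X)]
    refine le_generateFrom ?_
    rintro _ ⟨K, hK, U, hU, rfl⟩
    obtain ⟨L, hL, rfl⟩ := hq K hK
    refine ⟨_, ContinuousMap.isOpen_setOfPred_mapsTo hL hU, ?_⟩
    ext f
    change MapsTo (f.comp q) L U ↔ MapsTo f (q '' L) U
    exact (mapsTo_image_iff (f := f) (g := q)).symm
  · intro f g h
    ext x
    obtain ⟨s, rfl⟩ := hs x
    exact DFunLike.congr_fun h s

/-- Convergence in the compact-open topology implies continuous convergence along sequences. -/
theorem ContinuousMap.tendsto_apply_seq {f : ℕ → C(A, B)} {g : C(A, B)}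
    (hf : Tendsto f atTop (𝓝 g)) {u : ℕ → A} {a : A} (hu : Tendsto u atTop (𝓝 a)) :
    Tendsto (fun n => f n (u n)) atTop (𝓝 (g a)) := by
  refine tendsto_nhds.2 fun V hV ha => ?_
  obtain ⟨N, hN⟩ := eventually_atTop.1
    ((g.continuous.tendsto a).comp hu |>.eventually (hV.mem_nhds ha))
  -- Only the tail from `N` on is kept, so that `g` maps this whole compact set into `V`.
  have hC := ((tendsto_add_atTop_iff_nat N).2 hu).isCompact_insert_range
  have hm : MapsTo g (insert a (range fun n => u (n + N))) V := by
    rintro _ (rfl | ⟨n, rfl⟩)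
    · exact ha
    · exact hN _ (Nat.le_add_left _ _)
  filter_upwards [hf.eventually (ContinuousMap.eventually_mapsTo hC hV hm), eventually_ge_atTop N]
    with n hn hNn
  exact hn (Or.inr ⟨n - N, by simp [Nat.sub_add_cancel hNn]⟩)

/-- Uncurrying a continuous map preserves continuity if the product is sequential. -/
theorem ContinuousMap.continuous_uncurry_of_firstCountable [FirstCountableTopology S]
    [FirstCountableTopology A] (g : C(S, C(A, B))) :
    Continuous (Function.uncurry fun s a => g s a) := by
  refine continuous_iff_seqContinuous.2 fun u p hu => ?_
  exact ContinuousMap.tendsto_apply_seq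
    ((g.continuous.tendsto p.1).comp ((continuous_fst.tendsto p).comp hu))
    ((continuous_snd.tendsto p).comp hu)

/-- Continuity is tested on compact `K` and `L`; these are Hausdorff, so `K × L` is locally compact
and evaluation on it is jointly continuous. -/
theorem ContinuousMap.continuous_curry_of_t2 [T2Space S] [T2Space A] :
    Continuous (ContinuousMap.curry : C(S × A, B) → C(S, C(A, B))) := by
  refine ContinuousMap.continuous_of_restrict fun K hK => ?_
  refine ContinuousMap.continuous_of_continuous_uncurry _ ?_
  refine ContinuousMap.continuous_of_restrict fun L hL => ?_
  refine ContinuousMap.continuous_of_continuous_uncurry _ ?_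
  have := isCompact_iff_compactSpace.1 hK
  have := isCompact_iff_compactSpace.1 hL
  let j : C(K × L, S × A) := ⟨Prod.map Subtype.val Subtype.val, by fun_prop⟩
  have hj : Continuous fun p : (C(S × A, B) × K) × L => (p.1.1.comp j) (p.1.2, p.2) :=
    ((ContinuousMap.continuous_precomp j).comp (by fun_prop)).eval (by fun_prop)
  exact hj

/-- The exponential law for first countable Hausdorff spaces. -/
theorem ContinuousMap.isEmbedding_uncurry_of_firstCountable [T2Space S] [T2Space A]
    [FirstCountableTopology S] [FirstCountableTopology A] :
    IsEmbedding (fun g : C(S, C(A, B)) =>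
      (⟨_, g.continuous_uncurry_of_firstCountable⟩ : C(S × A, B))) := by
  -- Currying is a continuous left inverse, so only continuity of uncurrying remains. It is checked
  -- over the compact projections of `K`, where local compactness is available.
  refine IsEmbedding.of_comp ?_ ContinuousMap.continuous_curry_of_t2 IsEmbedding.id
  refine ContinuousMap.continuous_compactOpen.2 fun K hK U hU => ?_
  have hK₁ := hK.image continuous_fst
  have hK₂ := hK.image continuous_snd
  have := isCompact_iff_compactSpace.1 hK₁
  have := isCompact_iff_compactSpace.1 hK₂
  let K₁ := Prod.fst '' K
  let K₂ := Prod.snd '' K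
  let r : C(S, C(A, B)) → C(K₁, C(K₂, B)) := fun g =>
    (⟨fun f : C(A, B) => f.restrict K₂, ContinuousMap.continuous_restrict K₂⟩ :
      C(C(A, B), C(K₂, B))).comp (g.restrict K₁)
  have hr : Continuous r :=
    (ContinuousMap.continuous_postcomp _).comp (ContinuousMap.continuous_restrict K₁)
  have hj : IsClosedEmbedding (Prod.map Subtype.val Subtype.val : K₁ × K₂ → S × A) :=
    hK₁.isClosed.isClosedEmbedding_subtypeVal.prodMap hK₂.isClosed.isClosedEmbedding_subtypeVal
  have ho := (ContinuousMap.isOpen_setOfPred_mapsTo (hj.isCompact_preimage hK) hU).preimage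
    (ContinuousMap.continuous_uncurry.comp hr)
  convert ho using 1
  ext g
  constructor
  · rintro h ⟨s, a⟩ hz
    exact h hz
  · rintro h ⟨s, a⟩ hz
    exact @h (⟨s, mem_image_of_mem Prod.fst hz⟩, ⟨a, mem_image_of_mem Prod.snd hz⟩) hz

/-- The product of function spaces embeds into the space of maps between the sums. -/
theorem ContinuousMap.isEmbedding_sigmaMap {ι : Type*} {X Y : ι → Type*}
    [∀ i, TopologicalSpace (X i)] [∀ i, TopologicalSpace (Y i)] :
    IsEmbedding (fun f : ∀ i, C(X i, Y i) =>
      (⟨Sigma.map id fun i => f i, Continuous.sigma_map fun i => (f i).continuous⟩ :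
        C(Σ i, X i, Σ i, Y i))) := by
  let r : C(Σ i, X i, Σ i, Y i) → ∀ i, C(X i, Σ i, Y i) := fun f i =>
    f.comp ⟨Sigma.mk i, continuous_sigmaMk⟩
  have hr : Continuous r := continuous_pi fun i => ContinuousMap.continuous_precomp _
  have hp : IsEmbedding (Pi.map fun i (f : C(X i, Y i)) =>
      (⟨Sigma.mk i, continuous_sigmaMk⟩ : C(Y i, Σ i, Y i)).comp f) :=
    IsEmbedding.piMap fun i => ContinuousMap.isEmbedding_postcomp _ IsEmbedding.sigmaMk
  refine IsEmbedding.of_comp ?_ hr hp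
  refine ContinuousMap.continuous_compactOpen.2 fun K hK U hU => ?_
  -- A compact subset of a sum meets only finitely many summands.
  obtain ⟨s, t, hs, ht, rfl⟩ := hK.sigma_exists_finite_sigma_eq
  have ho : IsOpen (⋂ i ∈ s, {f : ∀ i, C(X i, Y i) | MapsTo (f i) (t i) (Sigma.mk i ⁻¹' U)}) :=
    hs.isOpen_biInter fun i _ =>
      IsOpen.preimage (t := {f : C(X i, Y i) | MapsTo f (t i) (Sigma.mk i ⁻¹' U)})
        (continuous_apply (A := fun i => C(X i, Y i)) i)
        (ContinuousMap.isOpen_setOfPred_mapsTo (ht i) (hU.preimage continuous_sigmaMk))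
  convert ho using 1
  ext f
  simp only [mem_iInter]
  exact ⟨fun h i hi x hx => @h ⟨i, x⟩ ⟨hi, hx⟩, fun h z hz => h z.1 hz.1 hz.2⟩

/-- A compact set of continuous maps on a first countable space is evenly continuous. -/
theorem IsCompact.exists_nhds_eventually_mapsTo [FirstCountableTopology A] [RegularSpace B]
    {e : X → C(A, B)} (he : Continuous e) {K : Set X} (hK : IsCompact K) (x : X) (a : A)
    {V : Set B} (hV : V ∈ 𝓝 (e x a)) :
    ∃ U ∈ 𝓝 a, ∀ᶠ y in 𝓝[K] x, MapsTo (e y) U V := by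
  wlog hVo : IsOpen V generalizing V
  · obtain ⟨W, hWV, hWo, hxW⟩ := mem_nhds_iff.1 hV
    obtain ⟨U, hU, h⟩ := this (hWo.mem_nhds hxW) hWo
    exact ⟨U, hU, h.mono fun y hy => hy.mono_right hWV⟩
  obtain ⟨F, hF, hFc, hFV⟩ := exists_mem_nhds_isClosed_subset hV
  have hev : Continuous fun y => e y a := (ContinuousEvalConst.continuous_eval_const a).comp he
  obtain ⟨U, hU⟩ := (𝓝 a).exists_antitone_basis
  by_contra! hcon
  have hex : ∀ k, ∃ y ∈ K ∩ (fun y => e y a) ⁻¹' F, ∃ b ∈ U k, e y b ∉ V := fun k => by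
    have hfr := hcon (U k) (hU.1.mem_of_mem trivial)
    have hev' : ∀ᶠ y in 𝓝[K] x, y ∈ K ∩ (fun y => e y a) ⁻¹' F :=
      inter_mem self_mem_nhdsWithin (mem_nhdsWithin_of_mem_nhds (hev.continuousAt hF))
    obtain ⟨y, hy, hyK⟩ := (hfr.and_eventually hev').exists
    simp only [MapsTo, not_forall] at hy
    obtain ⟨b, hb, hbV⟩ := hy
    exact ⟨y, hyK, b, hb, hbV⟩
  choose y hyK b hbU hbV using hex
  have hb : Tendsto b atTop (𝓝 a) := hU.tendsto hbU
  -- Closedness of `F` keeps `e z a` in `V` at the cluster point `z`. Then `e z`, and with it `e (y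
  -- n)` for arbitrarily large `n`, maps a tail of `b` into `V`.
  obtain ⟨z, hz, hcl⟩ := (hK.inter_right (hFc.preimage hev)).exists_mapClusterPt
    (f := atTop) (u := y) (tendsto_principal.2 (Eventually.of_forall hyK))
  have hza : e z a ∈ V := hFV hz.2
  obtain ⟨N, hN⟩ := eventually_atTop.1
    (((e z).continuous.tendsto a).comp hb |>.eventually (hVo.mem_nhds hza))
  have hC := ((tendsto_add_atTop_iff_nat N).2 hb).isCompact_insert_range
  have hm : MapsTo (e z) (insert a (range fun n => b (n + N))) V := by
    rintro _ (rfl | ⟨n, rfl⟩)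
    · exact hza
    · exact hN _ (Nat.le_add_left _ _)
  have hfr := hcl.frequently (he.continuousAt.eventually
    (ContinuousMap.eventually_mapsTo hC hVo hm))
  obtain ⟨n, hn, hNn⟩ := (hfr.and_eventually (eventually_ge_atTop N)).exists
  exact hbV n (hn (Or.inr ⟨n - N, by simp [Nat.sub_add_cancel hNn]⟩))

/-- The values of a Lindelöf family of maps from a separable space to a metrizable space lie in a
separable set. -/
theorem exists_isSeparable_forall_mem_of_lindelof [LindelofSpace X] [SeparableSpace A]
    [MetrizableSpace B] {e : X → C(A, B)} (he : Continuous e) :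
    ∃ s : Set B, IsSeparable s ∧ ∀ x a, e x a ∈ s := by
  obtain ⟨D, hDc, hD⟩ := exists_countable_dense A
  have := hDc.to_subtype
  refine ⟨closure (⋃ d : D, range fun x => e x d),
    (IsSeparable.iUnion fun d => ?_).closure, fun x a => ?_⟩
  · have hc : Continuous fun x => e x d := (ContinuousEvalConst.continuous_eval_const d.1).comp he
    have : LindelofSpace (range fun x => e x d) :=
      isLindelof_iff_lindelofSpace.1 (isLindelof_range hc)
    exact IsSeparable.of_subtype _
  · exact map_mem_closure (e x).continuous (hD a) fun d hd =>
      mem_iUnion.2 ⟨⟨d, hd⟩, mem_range_self x⟩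

end CompactOpen

/-! ### Compact-covering images of separable metrizable spaces -/

section CompactCovering

universe v

variable {X A B : Type v} [TopologicalSpace X] [TopologicalSpace A] [TopologicalSpace B]

/-- A code of a continuous map `f`: a set of pairs of basic open sets `(U, V)` with
`f '' U ⊆ closure V` that witnesses the continuity of `f` at all points. -/
def IsContinuityCode [SecondCountableTopology A] [SecondCountableTopology B] (f : C(A, B))
    (R : countableBasis A × countableBasis B → Bool) : Prop :=
  (∀ p, R p = true → MapsTo f p.1 (closure p.2)) ∧
    ∀ a, ∀ V ∈ 𝓝 (f a), ∃ p, R p = true ∧ a ∈ p.1.1 ∧ closure p.2.1 ⊆ V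

/-- A code determines its map, so decoding is well defined. -/
theorem IsContinuityCode.eq [SecondCountableTopology A] [SecondCountableTopology B] [T1Space B]
    {f g : C(A, B)} {R : countableBasis A × countableBasis B → Bool}
    (hf : IsContinuityCode f R) (hg : IsContinuityCode g R) : f = g := by
  ext a
  by_contra hne
  obtain ⟨p, hp, ha, hV⟩ := hf.2 a {g a}ᶜ (isOpen_compl_singleton.mem_nhds hne)
  exact hV (hg.1 p hp ha) rfl

/-- Each compact set of continuous maps is covered by a compact set of codes. -/
theorem exists_isCompact_isContinuityCode [SecondCountableTopology A] [SecondCountableTopology B]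
    [RegularSpace B] {e : X → C(A, B)} (he : Continuous e) {K : Set X} (hK : IsCompact K) :
    ∃ L : Set (countableBasis A × countableBasis B → Bool), IsCompact L ∧
      (∀ R ∈ L, ∃ x ∈ K, IsContinuityCode (e x) R) ∧
      ∀ x ∈ K, ∃ R ∈ L, IsContinuityCode (e x) R := by
  let P : countableBasis A × countableBasis B → Set X := fun p =>
    {x | MapsTo (e x) p.1 (closure p.2)}
  have hP : ∀ p, IsClosed (P p) := fun p =>
    (ContinuousMap.isClosed_setOfPred_mapsTo isClosed_closure _).preimage he
  -- Taking the closure of `K \ P p` makes `T` closed, at the price that both values of `R p` may be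
  -- allowed at some points.
  let T : Set (X × (countableBasis A × countableBasis B → Bool)) :=
    {z | ∀ p, z.2 p = true ∧ z.1 ∈ P p ∨ z.2 p = false ∧ z.1 ∈ closure (K \ P p)}
  have hT : IsClosed T := by
    have hTe : T = ⋂ p, {z | z.2 p = true ∧ z.1 ∈ P p ∨
        z.2 p = false ∧ z.1 ∈ closure (K \ P p)} := by
      ext z
      simp [T]
    rw [hTe]
    refine isClosed_iInter fun p => ?_
    have hc (b : Bool) : IsClosed {z : X × (countableBasis A × countableBasis B → Bool) |
        z.2 p = b} :=
      isClosed_eq ((continuous_apply (A := fun _ => Bool) p).comp continuous_snd)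
        continuous_const
    exact ((hc true).inter ((hP p).preimage continuous_fst)).union
      ((hc false).inter (isClosed_closure.preimage continuous_fst))
  have hcode : ∀ z ∈ (K ×ˢ univ) ∩ T, IsContinuityCode (e z.1) z.2 := by
    rintro ⟨x, R⟩ ⟨⟨hx, -⟩, hz⟩
    refine ⟨fun p hp => ?_, fun a V hV => ?_⟩
    · rcases hz p with h | h
      · exact h.2
      · simp_all
    · obtain ⟨F, hF, hFc, hFV⟩ := exists_mem_nhds_isClosed_subset hV
      obtain ⟨v, hv, hxv, hvF⟩ := (isBasis_countableBasis B).mem_nhds_iff.1 hF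
      -- Even continuity gives one box valid for all points of `K` near `x`. So `x` is not in the
      -- closure of `K \ P p`, which forces `R p = true`.
      obtain ⟨U, hU, hev⟩ := hK.exists_nhds_eventually_mapsTo he x a
        ((isOpen_of_mem_countableBasis hv).mem_nhds hxv)
      obtain ⟨u, hu, hau, huU⟩ := (isBasis_countableBasis A).mem_nhds_iff.1 hU
      refine ⟨(⟨u, hu⟩, ⟨v, hv⟩), ?_, hau, (closure_minimal hvF hFc).trans hFV⟩
      rcases hz (⟨u, hu⟩, ⟨v, hv⟩) with h | h
      · exact h.1
      · obtain ⟨y, hy, hyK⟩ :=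
          ((mem_closure_iff_frequently.1 h.2).and_eventually
            (eventually_nhdsWithin_iff.1 hev)).exists
        exact absurd ((hyK hy.1).mono huU subset_closure) hy.2
  refine ⟨Prod.snd '' ((K ×ˢ univ) ∩ T),
    ((hK.prod isCompact_univ).inter_right hT).image continuous_snd, ?_, fun x hx => ?_⟩
  · rintro _ ⟨z, hz, rfl⟩
    exact ⟨z.1, hz.1.1, hcode z hz⟩
  · classical
    have hz : (x, fun p => decide (x ∈ P p)) ∈ (K ×ˢ univ) ∩ T := by
      refine ⟨⟨hx, trivial⟩, fun p => ?_⟩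
      by_cases hp : x ∈ P p
      · exact Or.inl ⟨decide_eq_true hp, hp⟩
      · exact Or.inr ⟨decide_eq_false hp, subset_closure ⟨hx, hp⟩⟩
    exact ⟨_, mem_image_of_mem _ hz, hcode _ hz⟩

/-- A space of continuous maps between second countable regular spaces is a compact-covering image
of a separable metrizable space. -/
theorem exists_compactCovering_of_secondCountable [SecondCountableTopology A]
    [SecondCountableTopology B] [T3Space B] {e : X → C(A, B)} (he : IsEmbedding e) :
    ∃ (S : Type v) (_ : TopologicalSpace S) (q : C(S, X)),
      SeparableSpace S ∧ MetrizableSpace S ∧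
      ∀ K : Set X, IsCompact K → ∃ L : Set S, IsCompact L ∧ q '' L = K := by
  let S := {R : countableBasis A × countableBasis B → Bool | ∃ x, IsContinuityCode (e x) R}
  have : Countable (countableBasis A) := (countable_countableBasis A).to_subtype
  have : Countable (countableBasis B) := (countable_countableBasis B).to_subtype
  choose q hq using fun R : S => R.2
  have hqe : ∀ (R : S) x, IsContinuityCode (e x) R.1 → q R = x := fun R x hx =>
    he.injective ((hq R).eq hx)
  have hqc : Continuous q := by
    refine he.isInducing.continuous_iff.2 (ContinuousMap.continuous_of_continuous_uncurry _ ?_)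
    refine continuous_iff_continuousAt.2 ?_
    rintro ⟨R, a⟩ V hV
    -- The condition `R p = true` is open in the cube, so this single `p` controls all nearby codes.
    obtain ⟨p, hp, hap, hpV⟩ := (hq R).2 a V hV
    have h₁ : ∀ᶠ R' : S in 𝓝 R, R'.1 p = true :=
      ((continuous_apply p).comp continuous_subtype_val).continuousAt.eventually
        (show ∀ᶠ b in 𝓝 (R.1 p), b = true by rw [hp, nhds_discrete]; rfl)
    have h₂ : ∀ᶠ a' in 𝓝 a, a' ∈ p.1.1 :=
      (isOpen_of_mem_countableBasis p.1.2).mem_nhds hap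
    rw [nhds_prod_eq, mem_map]
    filter_upwards [h₁.prod_mk h₂] with z hz
    exact hpV ((hq z.1).1 p hz.1 hz.2)
  refine ⟨S, inferInstance, ⟨q, hqc⟩, inferInstance, inferInstance, fun K hK => ?_⟩
  obtain ⟨L, hL, hLK, hKL⟩ := exists_isCompact_isContinuityCode he.continuous hK
  have hLS : L ⊆ S := fun R hR => (hLK R hR).imp fun x hx => hx.2
  refine ⟨Subtype.val ⁻¹' L, ?_, ?_⟩
  · rw [Subtype.isCompact_iff, Subtype.image_preimage_coe, inter_eq_self_of_subset_right hLS]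
    exact hL
  · ext x
    constructor
    · rintro ⟨R, hR, rfl⟩
      obtain ⟨x, hx, hxR⟩ := hLK R.1 hR
      change q R ∈ K
      rwa [hqe R x hxR]
    · intro hx
      obtain ⟨R, hR, hxR⟩ := hKL x hx
      exact ⟨⟨R, x, hxR⟩, hR, hqe _ x hxR⟩

/-- A Lindelöf space of continuous maps from a separable metrizable space to a metrizable space is
a compact-covering image of a separable metrizable space. -/
theorem exists_compactCovering_of_lindelof [LindelofSpace X] [SeparableSpace A]
    [MetrizableSpace A] [MetrizableSpace B] {e : X → C(A, B)} (he : IsEmbedding e) :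
    ∃ (S : Type v) (_ : TopologicalSpace S) (q : C(S, X)),
      SeparableSpace S ∧ MetrizableSpace S ∧
      ∀ K : Set X, IsCompact K → ∃ L : Set S, IsCompact L ∧ q '' L = K := by
  obtain ⟨s, hs, hes⟩ := exists_isSeparable_forall_mem_of_lindelof he.continuous
  have := hs.secondCountableTopology
  have : SecondCountableTopology A :=
    SeparableSpace.secondCountableTopology_of_metrizable A
  -- Shrinking the codomain to the separable set `s` reduces to the second countable case.
  let e' : X → C(A, s) := fun x => ⟨fun a => ⟨e x a, hes x a⟩, by fun_prop⟩
  let i : C(s, B) := ⟨Subtype.val, continuous_subtype_val⟩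
  have hi : IsEmbedding (i.comp : C(A, s) → C(A, B)) :=
    ContinuousMap.isEmbedding_postcomp i IsEmbedding.subtypeVal
  have he' : IsEmbedding e' :=
    IsEmbedding.of_comp (hi.isInducing.continuous_iff.2 he.continuous) hi.continuous he
  exact exists_compactCovering_of_secondCountable he'

end CompactCovering

/-! ### Stability of the class of embeddable spaces -/

namespace SpaceClass

theorem ckEmb_of_isEmbedding {𝒳 𝒴 : SpaceClass.{u}} {Z W : Type u} [TopologicalSpace Z]
    [TopologicalSpace W] (h : ckEmb 𝒳 𝒴 W) {f : Z → W} (hf : IsEmbedding f) : ckEmb 𝒳 𝒴 Z := by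
  obtain ⟨X, Y, _, _, hX, hY, e, he⟩ := h
  exact ⟨X, Y, _, _, hX, hY, e ∘ f, he.comp hf⟩

theorem metrizable_sub_ckEmb : metrizable.{u}.Sub (ckEmb sepMetrizable metrizable) := by
  intro Z _ hZ
  exact ⟨PUnit, Z, inferInstance, inferInstance, ⟨inferInstance, inferInstance⟩, hZ,
    ContinuousMap.const PUnit, (Homeomorph.continuousMapOfUnique (X := PUnit) (Y := Z)).isEmbedding⟩

theorem metrizable_sigma {ι : Type*} {X : ι → Type*} [∀ i, TopologicalSpace (X i)]
    [∀ i, MetrizableSpace (X i)] : MetrizableSpace (Σ i, X i) := by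
  let := fun i => metrizableSpaceMetric (X i)
  let := Metric.Sigma.metricSpace (E := X)
  infer_instance

theorem ckEmb_pi {ι : Type} [Countable ι] (Z : ι → Type u) [∀ i, TopologicalSpace (Z i)]
    (h : ∀ i, ckEmb sepMetrizable metrizable (Z i)) :
    ckEmb sepMetrizable metrizable (∀ i, Z i) := by
  choose X Y _ _ hX hY e he using h
  have (i : ι) : SeparableSpace (X i) := (hX i).1
  have (i : ι) : MetrizableSpace (X i) := (hX i).2
  have (i : ι) : MetrizableSpace (Y i) := hY i
  have (i : ι) : SecondCountableTopology (X i) := SeparableSpace.secondCountableTopology_of_metrizable (X i)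
  exact ⟨Σ i, X i, Σ i, Y i, inferInstance, inferInstance, ⟨inferInstance, metrizable_sigma⟩,
    metrizable_sigma, _, ContinuousMap.isEmbedding_sigmaMap.comp (IsEmbedding.piMap he)⟩

theorem ckEmb_prod_of_forall_bool (F : Bool → Type u) [∀ b, TopologicalSpace (F b)]
    (h : ∀ b, ckEmb sepMetrizable metrizable (F b)) :
    ckEmb sepMetrizable metrizable (F false × F true) := by
  let f : F false × F true → ∀ b, F b := fun p b => Bool.rec p.1 p.2 b
  have hf : Continuous f := by
    refine continuous_pi fun b => ?_
    cases b
    exacts [continuous_fst, continuous_snd]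
  have hg : Continuous fun x : ∀ b, F b => (x false, x true) :=
    (continuous_apply false).prodMk (continuous_apply true)
  exact ckEmb_of_isEmbedding (ckEmb_pi F h) (IsEmbedding.of_comp hf hg IsEmbedding.id)

theorem ckEmb_prod {Z W : Type u} [tZ : TopologicalSpace Z] [tW : TopologicalSpace W]
    (hZ : ckEmb sepMetrizable metrizable Z) (hW : ckEmb sepMetrizable metrizable W) :
    ckEmb sepMetrizable metrizable (Z × W) :=
  @ckEmb_prod_of_forall_bool (fun b => Bool.rec Z W b) (fun b => Bool.rec tZ tW b)
    (fun b => by cases b; exacts [hZ, hW])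

/-- The sum embeds into the discrete index space times a product: the index separates the summands,
and a point of `Z i` replaces the `i`th coordinate of a base point. -/
theorem ckEmb_sigma {ι : Type} [Countable ι] (Z : ι → Type u) [∀ i, TopologicalSpace (Z i)]
    (h : ∀ i, ckEmb sepMetrizable metrizable (Z i)) :
    ckEmb sepMetrizable metrizable (Σ i, Z i) := by
  classical
  let : TopologicalSpace ι := ⊥
  have : DiscreteTopology ι := ⟨rfl⟩
  -- Empty summands are dropped, since they would make the product empty.
  let J := {i : ι // Nonempty (Z i)}
  let b : ∀ j : J, Z j.1 := fun j => j.2.some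
  have hι : ckEmb sepMetrizable metrizable (ULift.{u} ι) :=
    metrizable_sub_ckEmb _ (show MetrizableSpace (ULift.{u} ι) from
      Homeomorph.ulift.isEmbedding.metrizableSpace)
  have hJ : ckEmb sepMetrizable metrizable (∀ j : J, Z j.1) := ckEmb_pi _ fun j => h j.1
  let f : (Σ i, Z i) → ULift.{u} ι × ∀ j : J, Z j.1 := fun z =>
    (⟨z.1⟩, Function.update b ⟨z.1, ⟨z.2⟩⟩ z.2)
  refine ckEmb_of_isEmbedding (ckEmb_prod hι hJ) (f := f) ⟨inducing_sigma.2 ⟨fun i => ?_,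
    fun i => ⟨Prod.fst ⁻¹' {⟨i⟩}, (isOpen_discrete _).preimage continuous_fst, fun z => ?_⟩⟩, ?_⟩
  · rcases isEmpty_or_nonempty (Z i) with hi | hi
    · exact IsEmbedding.of_subsingleton _ |>.isInducing
    · have hc : Continuous fun z : Z i =>
          ((⟨i⟩, Function.update b ⟨i, hi⟩ z) : ULift.{u} ι × ∀ j : J, Z j.1) :=
        continuous_const.prodMk
          ((continuous_const (y := b)).update (⟨i, hi⟩ : J) (continuous_id (X := Z i)))
      have hg : Continuous fun p : ULift.{u} ι × ∀ j : J, Z j.1 => p.2 ⟨i, hi⟩ :=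
        (continuous_apply (A := fun j : J => Z j.1) ⟨i, hi⟩).comp continuous_snd
      refine IsInducing.of_comp hc hg ?_
      convert IsInducing.id (X := Z i)
      ext z
      simp [f]
  · simp [f]
  · rintro ⟨i, z⟩ ⟨j, w⟩ hzw
    obtain rfl : i = j := congrArg (fun p => p.1.down) hzw
    have := congrFun (congrArg Prod.snd hzw) ⟨i, ⟨z⟩⟩
    simp only [f, Function.update_self] at this
    rw [this]

theorem ckEmb_continuousMap {X Y : Type u} [TopologicalSpace X] [TopologicalSpace Y]
    [LindelofSpace X] (hX : ckEmb sepMetrizable metrizable X)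
    (hY : ckEmb sepMetrizable metrizable Y) : ckEmb sepMetrizable metrizable C(X, Y) := by
  obtain ⟨A', B', _, _, ⟨_, _⟩, hB', e', he'⟩ := hX
  obtain ⟨A, B, _, _, ⟨_, _⟩, hB, e, he⟩ := hY
  have : MetrizableSpace B' := hB'
  obtain ⟨S, _, q, _, _, hq⟩ := exists_compactCovering_of_lindelof he'
  exact ⟨S × A, B, inferInstance, inferInstance, ⟨inferInstance, inferInstance⟩, hB, _,
    ContinuousMap.isEmbedding_uncurry_of_firstCountable.comp
      ((ContinuousMap.isEmbedding_postcomp ⟨e, he.continuous⟩ he).comp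
        (ContinuousMap.isEmbedding_precomp_of_compactCovering q hq))⟩

theorem isCkStable_ckEmb : IsCkStable (ckEmb sepMetrizable.{u} metrizable.{u}) where
  regular := by
    rintro Z _ ⟨X, Y, _, _, -, hY, e, he⟩
    have : MetrizableSpace Y := hY
    exact he.t3Space
  subspace := fun _ _ h _ => ckEmb_of_isEmbedding h IsEmbedding.subtypeVal
  homeo := fun _ _ _ _ h e => ckEmb_of_isEmbedding h e.some.symm.isEmbedding
  sum := fun _ _ Z _ h => ckEmb_sigma Z h
  prod := fun _ _ Z _ h => ckEmb_pi Z h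
  funSpace := fun _ _ _ _ _ hX hY => ckEmb_continuousMap hX hY

end SpaceClass

theorem theoremt (Z : Type u) [TopologicalSpace Z] :
    SpaceClass.ckClosure SpaceClass.metrizable Z ↔
      SpaceClass.ckEmb SpaceClass.sepMetrizable SpaceClass.metrizable Z := by
  refine ⟨fun h => h _ SpaceClass.isCkStable_ckEmb SpaceClass.metrizable_sub_ckEmb, ?_⟩
  rintro ⟨X, Y, _, _, ⟨_, hX⟩, hY, e, he⟩ 𝒴 h𝒴 hm
  have : SecondCountableTopology X := SeparableSpace.secondCountableTopology_of_metrizable X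
  -- Second countability makes `X` Lindelöf, so `funSpace` applies.
  exact h𝒴.homeo _ _
    (h𝒴.subspace _ (h𝒴.funSpace X Y inferInstance (hm X hX) (hm Y hY)) (range e))
    ⟨he.toHomeomorph.symm⟩
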